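/- Let $\mathbb C_+$ be the open upper half-plane and let $\mathbf H_2(\mathbb C_+)$ be its Hardy space, that is, the reproducing kernel Hilbert space of functions on $\mathbb C_+$ with reproducing kernel $\frac{1}{-i(\lambda-\nu^*)}$, where ${}^*$ denotes complex conjugation. Let $\ell$ be the set of finitely supported sequences $\alpha=(\alpha_1,\alpha_2,\dots)$ of non-negative integers, and write $z^\alpha=\prod_j z_j^{\alpha_j}$ and $(2\mathbb N)^\alpha=\prod_j(2j)^{\alpha_j}$. For an integer $k\ge 1$ put $$\mathbb K_k=\Big\{z\in\mathbb C^{\mathbb N}:\ \sum_{\alpha\in\ell}|z|^{2\alpha}(2\mathbb N)^{k\alpha}<\infty\Big\},\qquad K_k(z,w)=\sum_{\alpha\in\ell}z^\alpha (w^*)^\alpha(2\mathbb N)^{k\alpha}\quad(z,w\in\mathbb K_k),$$ and let $\mathcal H(K_k)$ be the reproducing kernel Hilbert space of functions on $\mathbb K_k$ with reproducing kernel $K_k$. Elements of the Hilbert space tensor product $\mathbf H_2(\mathbb C_+)\otimes\mathcal H(K_k)$ are regarded as functions $f(\lambda,z)$ on $\mathbb C_+\times\mathbb K_k$, where $f_1\otimes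 f_2$ is the function $f_1(\lambda)f_2(z)$. **Theorem.** Let $T$ be a linear operator from $\mathbf H_2(\mathbb C_+)\otimes\mathcal H(K_k)$ into itself with $\|Tf\|\le\|f\|$ for all $f$, and such that $$T(\chi_t f)=\chi_t\,Tf\quad(t\ge 0),\qquad T(z_jf)=z_j\,Tf\quad(j=1,2,\dots)$$ for all $f$, where $\chi_t(\lambda)=e^{it\lambda}$. Then there is a function $\mathscr H:\mathbb C_+\times\mathbb K_k\to\mathbb C$ such that $(Tf)(\lambda,z)=\mathscr H(\lambda,z)f(\lambda,z)$ for all $f$ and all $(\lambda,z)\in\mathbb C_+\times\mathbb K_k$, and such that the kernel $$\big(1-\mathscr H(\lambda,z)\mathscr H(\nu,w)^*\big)\frac{K_k(z,w)}{-i(\lambda-\nu^*)}$$ is positive (semidefinite) on $\mathbb C_+\times\mathbb K_k$. -/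

import Mathlib

open scoped TensorProduct ComplexConjugate ComplexOrder

noncomputable section

/-! ### Reproducing kernel Hilbert spaces of scalar kernels -/

/-- A complex-valued kernel `κ` on `X`, seen as a kernel with values in the operators on `ℂ`
(the form in which Mathlib takes the kernel of a reproducing kernel Hilbert space). -/
def scalarKernel {X : Type*} (κ : X → X → ℂ) : Matrix X X (ℂ →L[ℂ] ℂ) :=
  Matrix.of fun x y => κ x y • ContinuousLinearMap.id ℂ ℂ

/-- A kernel of the form `∑ i, φ i x * conj (φ i y)` is positive. -/
theorem scalarKernel_posSemidef {X ι : Type*} {κ : X → X → ℂ} (φ : ι → X → ℂ)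
    (hφ : ∀ x, Summable fun i => ‖φ i x‖ ^ 2)
    (hκ : ∀ x y, HasSum (fun i => φ i x * conj (φ i y)) (κ x y)) :
    (scalarKernel κ).PosSemidef := by
  have hmem : ∀ x, Memℓp (fun i => φ i x) 2 := fun x => by
    refine memℓp_gen ?_
    simpa using hφ x
  let Φ : X → ↥(lp (fun _ : ι => ℂ) (2 : ENNReal)) := fun x => ⟨fun i => φ i x, hmem x⟩
  have hΦ : ∀ x y, κ x y = inner ℂ (Φ y) (Φ x) := fun x y => by
    refine (hκ x y).unique ?_
    simpa using lp.hasSum_inner (𝕜 := ℂ) (Φ y) (Φ x)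
  have h := (RKHS.posSemidef_tfae (K := scalarKernel κ)).out 0 2
  rw [h]
  refine ⟨?_, fun vv => ?_⟩
  · ext x y
    simp [scalarKernel, Matrix.conjTranspose_apply, hΦ,
      ← ContinuousLinearMap.one_def]
  · have : (vv.sum fun x w => vv.sum fun x' w' => inner ℂ (scalarKernel κ x' x w) w')
        = inner ℂ (vv.sum fun x w => conj w • Φ x) (vv.sum fun x w => conj w • Φ x) := by
      simp only [Finsupp.sum_inner, Finsupp.inner_sum, inner_smul_left, inner_smul_right]
      simp [scalarKernel, hΦ, Finsupp.mul_sum, mul_comm, mul_assoc]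
    rw [this]
    exact inner_self_nonneg

/-! ### The Hardy space of the upper half-plane -/

/-- The kernel `1 / (-i (λ - ν*))` on the open upper half-plane. -/
def szegoKernel (l ν : UpperHalfPlane) : ℂ :=
  1 / (-Complex.I * ((l : ℂ) - conj (ν : ℂ)))

theorem szegoKernel_posSemidef : (scalarKernel szegoKernel).PosSemidef := by
  let u : UpperHalfPlane → ℂ := fun l => ((l : ℂ) - Complex.I) / ((l : ℂ) + Complex.I)
  have hne : ∀ l : UpperHalfPlane, (l : ℂ) + Complex.I ≠ 0 := fun l h => by
    have := congrArg Complex.im h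
    have := l.im_pos
    simp at *
    linarith
  have hu : ∀ l, ‖u l‖ < 1 := fun l => by
    have hl := l.im_pos
    simp only [u, norm_div]
    rw [div_lt_one (norm_pos_iff.mpr (hne l)), ← sq_lt_sq₀ (norm_nonneg _) (norm_nonneg _),
      ← Complex.normSq_eq_norm_sq, ← Complex.normSq_eq_norm_sq]
    simp [Complex.normSq_apply]
    nlinarith
  refine scalarKernel_posSemidef
    (fun (n : ℕ) l => (Real.sqrt 2 : ℂ) * u l ^ n / ((l : ℂ) + Complex.I)) (fun l => ?_)
    (fun l ν => ?_)
  · have h1 : ‖u l‖ ^ 2 < 1 := by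
      have := hu l
      have := norm_nonneg (u l)
      nlinarith
    have := (summable_geometric_of_lt_one (sq_nonneg ‖u l‖) h1).mul_left
      (2 / ‖(l : ℂ) + Complex.I‖ ^ 2)
    refine this.congr fun n => ?_
    generalize u l = v
    rw [norm_div, norm_mul, norm_pow, div_pow, mul_pow, ← pow_mul, ← pow_mul, mul_comm n 2,
      Complex.norm_real, Real.norm_eq_abs, sq_abs, Real.sq_sqrt (by norm_num)]
    ring
  · have hlt : ‖u l * conj (u ν)‖ < 1 := by
      rw [norm_mul, RCLike.norm_conj]
      have h1 := hu l
      have h2 := hu ν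
      have := norm_nonneg (u l)
      have := norm_nonneg (u ν)
      nlinarith
    have hs := (hasSum_geometric_of_norm_lt_one hlt).mul_left
      (2 / (((l : ℂ) + Complex.I) * conj ((ν : ℂ) + Complex.I)))
    have hsq : (Real.sqrt 2 : ℂ) * (Real.sqrt 2 : ℂ) = 2 := by
      rw [← Complex.ofReal_mul, Real.mul_self_sqrt (by norm_num)]; norm_num
    have hl := hne l
    have hν : conj (ν : ℂ) - Complex.I ≠ 0 := fun h => hne ν (by
      have := congrArg conj h
      simpa using this)
    have hlν : (l : ℂ) - conj (ν : ℂ) ≠ 0 := fun h => by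
      have := congrArg Complex.im h
      have := l.im_pos
      have := ν.im_pos
      simp at *
      linarith
    have e1 : ∀ n : ℕ, (Real.sqrt 2 : ℂ) * u l ^ n / ((l : ℂ) + Complex.I) *
        conj ((Real.sqrt 2 : ℂ) * u ν ^ n / ((ν : ℂ) + Complex.I)) =
        2 / (((l : ℂ) + Complex.I) * conj ((ν : ℂ) + Complex.I)) * (u l * conj (u ν)) ^ n := by
      intro n
      generalize u l = v
      generalize u ν = w
      generalize (ν : ℂ) + Complex.I = d
      generalize (l : ℂ) + Complex.I = c
      rw [map_div₀, map_mul, map_pow, Complex.conj_ofReal, mul_pow, ← hsq]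
      ring
    have e2 : 2 / (((l : ℂ) + Complex.I) * conj ((ν : ℂ) + Complex.I)) *
        (1 - u l * conj (u ν))⁻¹ = szegoKernel l ν := by
      have h3 : 1 - u l * conj (u ν) = 2 * (-Complex.I * ((l : ℂ) - conj (ν : ℂ))) /
          (((l : ℂ) + Complex.I) * (conj (ν : ℂ) - Complex.I)) := by
        simp only [u, map_div₀, map_sub, map_add, Complex.conj_I, sub_neg_eq_add,
          ← sub_eq_add_neg]
        field_simp
        ring
      rw [h3, szegoKernel]
      simp only [map_add, Complex.conj_I, ← sub_eq_add_neg]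
      have hI := Complex.I_ne_zero
      field_simp
    rw [← e2]
    simpa only [e1] using hs

instance : Fact (scalarKernel szegoKernel).PosSemidef := ⟨szegoKernel_posSemidef⟩

/-- The Hardy space `H₂(ℂ₊)` of the open upper half-plane: the reproducing kernel Hilbert space
with reproducing kernel `1 / (-i (λ - ν*))`. -/
abbrev Hardy : Type := RKHS.OfKernel (scalarKernel szegoKernel)

/-! ### The space `H(K_k)` -/

/-- `z ^ α = ∏ j, z j ^ α j` for a finitely supported multi-index `α` over `{1, 2, …}`. -/
def multiPow (z : ℕ+ → ℂ) (α : ℕ+ →₀ ℕ) : ℂ := α.prod fun j n => z j ^ n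

/-- `(2ℕ) ^ α = ∏ j, (2 j) ^ α j`. -/
def twoNPow (α : ℕ+ →₀ ℕ) : ℝ := α.prod fun j n => (2 * (j : ℝ)) ^ n

/-- The neighbourhood `𝕂_k` of the origin: all `z` with `∑ |z| ^ (2α) (2ℕ) ^ (kα) < ∞`. -/
def kNhd (k : ℕ) : Set (ℕ+ → ℂ) :=
  {z | Summable fun α : ℕ+ →₀ ℕ => ‖multiPow z α‖ ^ 2 * twoNPow α ^ k}

/-- The kernel `K_k(z, w) = ∑ z ^ α (w*) ^ α (2ℕ) ^ (kα)`. -/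
def kKernel (k : ℕ) (z w : kNhd k) : ℂ :=
  ∑' α : ℕ+ →₀ ℕ, multiPow z α * multiPow (fun j => conj (w.1 j)) α * (twoNPow α : ℂ) ^ k

theorem kKernel_posSemidef (k : ℕ) : (scalarKernel (kKernel k)).PosSemidef := by
  have hpos : ∀ α, 0 ≤ twoNPow α := fun α =>
    Finset.prod_nonneg fun j _ => by positivity
  have hsq : ∀ α, Real.sqrt (twoNPow α ^ k) ^ 2 = twoNPow α ^ k := fun α =>
    Real.sq_sqrt (pow_nonneg (hpos α) k)
  let φ : (ℕ+ →₀ ℕ) → kNhd k → ℂ := fun α z =>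
    multiPow z α * (Real.sqrt (twoNPow α ^ k) : ℂ)
  have hφ : ∀ z, Summable fun α => ‖φ α z‖ ^ 2 := fun z => by
    refine z.2.congr fun α => ?_
    simp only [φ]
    rw [norm_mul, mul_pow, Complex.norm_real, Real.norm_eq_abs, sq_abs, hsq]
  refine scalarKernel_posSemidef φ hφ fun z w => ?_
  have hsum : Summable fun α => φ α z * conj (φ α w) := by
    refine Summable.of_norm_bounded ((hφ z).add (hφ w)) fun α => ?_
    rw [norm_mul, RCLike.norm_conj]
    nlinarith [sq_nonneg (‖φ α z‖ - ‖φ α w‖), sq_nonneg ‖φ α z‖, sq_nonneg ‖φ α w‖]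
  convert hsum.hasSum using 1
  refine tsum_congr fun α => ?_
  have h1 : multiPow (fun j => conj (w.1 j)) α = conj (multiPow w α) := by
    simp [multiPow, Finsupp.prod]
  have h2 : (Real.sqrt (twoNPow α ^ k) : ℂ) * (Real.sqrt (twoNPow α ^ k) : ℂ)
      = (twoNPow α : ℂ) ^ k := by
    rw [← Complex.ofReal_mul, ← sq, hsq, Complex.ofReal_pow]
  simp only [φ, map_mul, Complex.conj_ofReal]
  rw [h1, ← h2]
  ring

instance (k : ℕ) : Fact (scalarKernel (kKernel k)).PosSemidef := ⟨kKernel_posSemidef k⟩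

/-- `H(K_k)`: the reproducing kernel Hilbert space with reproducing kernel `K_k`. -/
abbrev KSpace (k : ℕ) : Type := RKHS.OfKernel (scalarKernel (kKernel k))

/-! ### The Hilbert space tensor product, as a space of functions on `ℂ₊ × 𝕂_k` -/

/-- `H₂(ℂ₊) ⊗ H(K_k)`: the Hilbert space tensor product, that is, the completion of the
algebraic tensor product for the inner product `⟪f ⊗ g, f' ⊗ g'⟫ = ⟪f, f'⟫ * ⟪g, g'⟫`. -/
abbrev HardyTensor (k : ℕ) : Type := UniformSpace.Completion (Hardy ⊗[ℂ] KSpace k)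

/-- The tensor `f ⊗ g` as an element of `H₂(ℂ₊) ⊗ H(K_k)`. -/
def pureTensor {k : ℕ} (f : Hardy) (g : KSpace k) : HardyTensor k :=
  ((f ⊗ₜ[ℂ] g : Hardy ⊗[ℂ] KSpace k) : UniformSpace.Completion (Hardy ⊗[ℂ] KSpace k))

/-- The tensor product of the two kernel functions at `λ` and `z`. -/
def kernelTensor {k : ℕ} (p : UpperHalfPlane × kNhd k) : HardyTensor k :=
  pureTensor (RKHS.kerFun Hardy p.1 1) (RKHS.kerFun (KSpace k) p.2 1)

theorem eq_zero_of_inner_kernelTensor {k : ℕ} (F : HardyTensor k)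
    (h : ∀ p, inner ℂ (kernelTensor p) F = 0) : F = 0 := by
  have key : ∀ (H X : Type) [NormedAddCommGroup H] [InnerProductSpace ℂ H] [CompleteSpace H]
      [RKHS ℂ H X ℂ] (L : H →L[ℂ] ℂ), (∀ x, L (RKHS.kerFun H x 1) = 0) → ∀ f, L f = 0 := by
    intro H X _ _ _ _ L hL f
    have hle : Submodule.topologicalClosure
        (Submodule.span ℂ {RKHS.kerFun H x v | (x : X) (v : ℂ)}) ≤ LinearMap.ker (L : H →ₗ[ℂ] ℂ) := by
      refine Submodule.topologicalClosure_minimal _ (Submodule.span_le.mpr ?_) L.isClosed_ker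
      rintro _ ⟨x, v, rfl⟩
      have : RKHS.kerFun H x v = v • RKHS.kerFun H x 1 := by
        rw [← map_smul, smul_eq_mul, mul_one]
      simp [this, hL]
    rw [RKHS.kerFun_dense] at hle
    exact hle Submodule.mem_top
  let J : Hardy →L[ℂ] KSpace k →L[ℂ] HardyTensor k :=
    (ContinuousLinearMap.compL ℂ (KSpace k) (Hardy ⊗[ℂ] KSpace k) (HardyTensor k)
      UniformSpace.Completion.toComplL) ∘L TensorProduct.mkL ℂ Hardy (KSpace k)
  have hJ : ∀ f g, J f g = pureTensor f g := fun f g => rfl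
  have h1 : ∀ f z, inner ℂ F (J f (RKHS.kerFun (KSpace k) z 1)) = 0 := fun f z =>
    key Hardy UpperHalfPlane
      ((innerSL ℂ F) ∘L (J.flip (RKHS.kerFun (KSpace k) z 1)))
      (fun l => inner_eq_zero_symm.mp (h (l, z))) f
  have h2 : ∀ f g, inner ℂ F (J f g) = 0 := fun f g =>
    key (KSpace k) (kNhd k) ((innerSL ℂ F) ∘L (J f)) (fun z => h1 f z) g
  refine UniformSpace.Completion.denseRange_coe.eq_zero_of_inner_left ℂ fun x => ?_
  induction x with
  | zero =>
    rw [UniformSpace.Completion.coe_zero, inner_zero_right]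
  | tmul f g => exact h2 f g
  | add a b ha hb =>
    rw [UniformSpace.Completion.coe_add, inner_add_right, ha, hb, add_zero]

/-- Elements of `H₂(ℂ₊) ⊗ H(K_k)` as functions of `(λ, z)`: evaluation at `(λ, z)` is the bounded
linear functional that takes `f ⊗ g` to `f(λ) g(z)`. -/
instance instRKHSHardyTensor (k : ℕ) :
    RKHS ℂ (HardyTensor k) (UpperHalfPlane × kNhd k) ℂ where
  coeCLM := ContinuousLinearMap.pi fun p => innerSL ℂ (kernelTensor p)
  coeCLM_injective := by
    refine (injective_iff_map_eq_zero _).mpr fun F hF => ?_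
    exact eq_zero_of_inner_kernelTensor F fun p => congrFun hF p

theorem pureTensor_apply {k : ℕ} (f : Hardy) (g : KSpace k) (p : UpperHalfPlane × kNhd k) :
    (pureTensor f g : HardyTensor k) p = f p.1 * g p.2 := by
  change inner ℂ (kernelTensor p) (pureTensor f g) = _
  simp [kernelTensor, pureTensor, UniformSpace.Completion.inner_coe]

/-- The reproducing kernel of `H₂(ℂ₊) ⊗ H(K_k)` is `K_k(z, w) / (-i (λ - ν*))`. -/
theorem kernel_hardyTensor {k : ℕ} (p q : UpperHalfPlane × kNhd k) :
    RKHS.kernel (HardyTensor k) p q 1 =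
      kKernel k p.2 q.2 / (-Complex.I * ((p.1 : ℂ) - conj (q.1 : ℂ))) := by
  have h : RKHS.kerFun (HardyTensor k) q 1 = kernelTensor q := by
    refine ext_inner_right ℂ fun F => ?_
    rw [RKHS.kerFun_inner]
    simp only [RCLike.inner_apply, map_one, mul_one]
    rfl
  have h1 : RKHS.kernel Hardy = scalarKernel szegoKernel := RKHS.OfKernel.kernel_ofKernel
  have h2 : RKHS.kernel (KSpace k) = scalarKernel (kKernel k) := RKHS.OfKernel.kernel_ofKernel
  rw [← RKHS.kerFun_apply, h, kernelTensor, pureTensor_apply, RKHS.kerFun_apply,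
    RKHS.kerFun_apply, h1, h2]
  simp only [scalarKernel, Matrix.of_apply, smul_apply,
    ContinuousLinearMap.id_apply, smul_eq_mul, szegoKernel]
  ring

/-- `T` commutes with multiplication by `φ`: whenever `G = φ F`, then `T G = φ (T F)`. -/
def CommutesWithMul {k : ℕ} (T : HardyTensor k →ₗ[ℂ] HardyTensor k)
    (φ : UpperHalfPlane × kNhd k → ℂ) : Prop :=
  ∀ F G : HardyTensor k, (∀ p, G p = φ p * F p) → ∀ p, (T G) p = φ p * (T F) p

end

noncomputable section

open MeasureTheory Set

/-! ### Total families and feature maps -/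

/-! Fix `p = (λ, z)`. The functional `L = ev_p ∘ T` is bounded and turns multiplication by `χ_s` and
`z_j` into multiplication by the numbers `χ_s(λ)` and `z_j`. Such an `L` is a multiple of `ev_p`
(`HardyTensor.functional_eq_smul_eval`), and the factor is the value of the multiplier at `p`.

It suffices to compare functionals on total families adapted to the multipliers. In `H(K_k)` these
are the monomials, all generated from `1` by the `z_j`. In the Hardy space they are the Laplace
transforms `u_s = (χ_s - 1)/(iλ)` of the indicators of `(0, s]`, which satisfy `u_{s+t} = u_s + χ_s
u_t`. Exchanging `s` and `t` fixes the values of the functional up to one scalar. Totality is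
transported through feature maps, from `L²(0, ∞)` and from `ℓ²`.

Finally, `T* k_p = conj (S p) k_p`, so the kernel in the conclusion is the Gram kernel of `1 - T
T*`, which is positive because `T` is a contraction. -/

theorem clm_eq_of_total {ι H : Type*} [NormedAddCommGroup H] [InnerProductSpace ℂ H]
    [CompleteSpace H] {e : ι → H} (he : ∀ f : H, (∀ i, inner ℂ (e i) f = 0) → f = 0)
    {a b : H →L[ℂ] ℂ} (hab : ∀ i, a (e i) = b (e i)) : a = b := by
  have hw : (InnerProductSpace.toDual ℂ H).symm (a - b) = 0 := he _ fun i => by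
    rw [inner_eq_zero_symm, InnerProductSpace.toDual_symm_apply]
    simp [hab]
  exact sub_eq_zero.mp ((LinearIsometryEquiv.map_eq_zero_iff _).mp hw)

section Feature

variable {X H E : Type*} [NormedAddCommGroup H] [InnerProductSpace ℂ H] [CompleteSpace H]
  [RKHS ℂ H X ℂ] [NormedAddCommGroup E] [InnerProductSpace ℂ E] [CompleteSpace E]

theorem RKHS.inner_kerFun_one (f : H) (x : X) : inner ℂ (RKHS.kerFun H x 1) f = f x := by
  simp

theorem RKHS.inner_kerFun_kerFun_one (x y : X) :
    inner ℂ (RKHS.kerFun H x 1) (RKHS.kerFun H y 1) = RKHS.kernel H x y 1 := by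
  rw [RKHS.inner_kerFun_one, RKHS.kerFun_apply]

theorem RKHS.denseRange_linearCombination_kerFun :
    DenseRange (Finsupp.linearCombination ℂ fun x : X => RKHS.kerFun H x 1) := by
  have h := RKHS.kerFun_dense H
  have hs : Submodule.span ℂ {RKHS.kerFun H x v | (x : X) (v : ℂ)} ≤
      LinearMap.range (Finsupp.linearCombination ℂ fun x : X => RKHS.kerFun H x 1) := by
    refine Submodule.span_le.mpr ?_
    rintro _ ⟨x, v, rfl⟩
    refine ⟨Finsupp.single x v, ?_⟩
    rw [Finsupp.linearCombination_single, ← map_smul, smul_eq_mul, mul_one]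
  have h2 := Submodule.topologicalClosure_mono hs
  rw [h, top_le_iff] at h2
  exact Submodule.dense_iff_topologicalClosure_eq_top.mpr h2

/-- If the kernel of `H` is the Gram kernel of vectors `v x` of a Hilbert space `E`, then every
`g : E` gives an element `x ↦ ⟪v x, g⟫` of `H`. -/
theorem RKHS.exists_feature_map (v : X → E)
    (hv : ∀ x y, RKHS.kernel H x y 1 = inner ℂ (v x) (v y)) :
    ∃ Φ : E →L[ℂ] H, ∀ g x, Φ g x = inner ℂ (v x) g := by
  let A := Finsupp.linearCombination ℂ fun x : X => RKHS.kerFun H x 1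
  let B := Finsupp.linearCombination ℂ v
  -- Equal Gram kernels make `k_x ↦ v x` isometric on the span of the kernel functions. Its
  -- extension `W` has the feature map as adjoint.
  have hAB : ∀ c, inner ℂ (A c) (A c) = inner ℂ (B c) (B c) := fun c => by
    simp only [A, B, Finsupp.linearCombination_apply, Finsupp.sum_inner, Finsupp.inner_sum,
      inner_smul_left, inner_smul_right, RKHS.inner_kerFun_kerFun_one, hv]
  have hn : ∀ c, ‖B c‖ ≤ 1 * ‖A c‖ := fun c => by
    rw [one_mul, @norm_eq_sqrt_re_inner ℂ, @norm_eq_sqrt_re_inner ℂ _ _ _ _ (A c), hAB]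
  have hA : DenseRange A := RKHS.denseRange_linearCombination_kerFun
  let W : H →L[ℂ] E := B.extendOfNorm A
  have hW : ∀ x, W (RKHS.kerFun H x 1) = v x := fun x => by
    have := LinearMap.extendOfNorm_eq hA ⟨1, hn⟩ (Finsupp.single x 1)
    simpa [A, B] using this
  refine ⟨W.adjoint, fun g x => ?_⟩
  rw [← RKHS.inner_kerFun_one, ContinuousLinearMap.adjoint_inner_right, hW]

/-- A total family of the feature space gives a total family of the function space. -/
theorem RKHS.exists_total {ι : Type*} (v : X → E)
    (hv : ∀ x y, RKHS.kernel H x y 1 = inner ℂ (v x) (v y)) {e : ι → E}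
    (he : ∀ f : E, (∀ i, inner ℂ (e i) f = 0) → f = 0) :
    ∃ u : ι → H, (∀ i x, u i x = inner ℂ (v x) (e i)) ∧
      ∀ f : H, (∀ i, inner ℂ (u i) f = 0) → f = 0 := by
  obtain ⟨Φ, hΦ⟩ := RKHS.exists_feature_map (H := H) v hv
  refine ⟨fun i => Φ (e i), fun i x => hΦ _ _, fun f hf => ?_⟩
  have h0 : Φ.adjoint f = 0 := he _ fun i => by
    rw [ContinuousLinearMap.adjoint_inner_right, hf]
  refine RKHS.ext fun x => ?_
  -- Kernel functions lie in the range of `Φ`, so `Φ* f = 0` forces every value `f x` to vanish.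
  have hk : RKHS.kerFun H x 1 = Φ (v x) := RKHS.ext fun y => by
    rw [hΦ, RKHS.kerFun_apply, hv]
  rw [← RKHS.inner_kerFun_one, hk, ← ContinuousLinearMap.adjoint_inner_right, h0,
    inner_zero_right, RKHS.coe_zero, Pi.zero_apply]

end Feature

/-! ### A total family of the Hardy space -/

/-- The indicators of the half-lines `(-∞, s]` are total in `L²(μ)` when these have finite
measure. -/
theorem indicator_Iic_total {μ : Measure ℝ} (hfin : ∀ s : ℝ, μ (Iic s) ≠ ⊤) (f : Lp ℂ 2 μ)
    (hf : ∀ s : ℝ, ∫ x in Iic s, f x ∂μ = 0) : f = 0 := by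
  have hint : ∀ s : ℝ, IntegrableOn f (Iic s) μ := fun s =>
    integrableOn_Lp_of_measure_ne_top f fact_one_le_two_ennreal.elim (hfin s)
  -- On a half-line of finite measure `f` is integrable. The half-lines form a π-system generating
  -- the Borel sets, so the integral of `f` vanishes over every Borel subset.
  have hn : ∀ n : ℕ, f =ᵐ[μ.restrict (Iic (n : ℝ))] 0 := fun n => by
    suffices h : ∀ A, MeasurableSet A → ∫ x in A, f x ∂(μ.restrict (Iic (n : ℝ))) = 0 from
      (hint n).ae_eq_zero_of_forall_setIntegral_eq_zero fun A hA _ => h A hA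
    intro A hA
    induction A, hA using MeasurableSpace.induction_on_inter
      (borel_eq_generateFrom_Iic ℝ ▸ BorelSpace.measurable_eq) isPiSystem_Iic with
    | empty => simp
    | basic t ht =>
      obtain ⟨s, rfl⟩ := ht
      rw [Measure.restrict_restrict measurableSet_Iic, Iic_inter_Iic]
      exact hf _
    | compl t ht ih => rw [setIntegral_compl ht (hint n), ih, hf, sub_zero]
    | iUnion g hd hm ih =>
      rw [integral_iUnion hm hd (hint n).integrableOn]
      simp [ih]
  have h : f =ᵐ[μ] 0 := by
    have hU : (⋃ n : ℕ, Iic (n : ℝ)) = univ :=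
      eq_univ_of_forall fun x => mem_iUnion.mpr (exists_nat_ge x)
    have := (ae_restrict_iUnion_iff (μ := μ) (fun n : ℕ => Iic (n : ℝ)) fun x => f x = 0).mpr hn
    rwa [hU, Measure.restrict_univ] at this
  exact (Lp.eq_zero_iff_ae_eq_zero).mpr h

theorem norm_exp_mul_sq (a : ℂ) (t : ℝ) : ‖Complex.exp (a * t)‖ ^ 2 = Real.exp (2 * a.re * t) := by
  rw [Complex.norm_exp, ← Real.exp_nat_mul]
  simp
  ring

theorem memLp_exp_mul {a : ℂ} (ha : a.re < 0) :
    MemLp (fun t : ℝ => Complex.exp (a * t)) 2 (volume.restrict (Ioi (0 : ℝ))) := by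
  refine (memLp_two_iff_integrable_sq_norm (by fun_prop)).mpr ?_
  simp only [norm_exp_mul_sq]
  exact integrableOn_exp_mul_Ioi (by linarith) 0

/-- The functions `(exp (i s λ) - 1) / (i λ)`, `0 ≤ s`, belong to the Hardy space and are total. -/
theorem Hardy.exists_total : ∃ u : ℝ → Hardy,
    (∀ s, 0 ≤ s → ∀ l : UpperHalfPlane,
      u s l = (Complex.exp (Complex.I * s * l) - 1) / (Complex.I * l)) ∧
    (∀ s, s < 0 → u s = 0) ∧
    ∀ f : Hardy, (∀ s, inner ℂ (u s) f = 0) → f = 0 := by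
  let μ := volume.restrict (Ioi (0 : ℝ))
  -- The conjugate makes `⟪v l, g⟫ = ∫ exp(i l t) g(t) dt` over `(0, ∞)`, which is holomorphic in
  -- `l`.
  let a : UpperHalfPlane → ℂ := fun l => -Complex.I * conj (l : ℂ)
  have ha : ∀ l, (a l).re < 0 := fun l => by simpa [a] using l.im_pos
  let v : UpperHalfPlane → Lp ℂ 2 μ := fun l => (memLp_exp_mul (ha l)).toLp _
  have hc : ∀ l, (v l : ℝ → ℂ) =ᵐ[μ] fun t : ℝ => Complex.exp (a l * t) := fun l =>
    MemLp.coeFn_toLp _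
  have hfin : ∀ s : ℝ, μ (Iic s) ≠ ⊤ := fun s => by
    rw [Measure.restrict_apply measurableSet_Iic, Iic_inter_Ioi]
    exact measure_Ioc_lt_top.ne
  have hv : ∀ x y, RKHS.kernel Hardy x y 1 = inner ℂ (v x) (v y) := fun x y => by
    have h1 : RKHS.kernel Hardy = scalarKernel szegoKernel := RKHS.OfKernel.kernel_ofKernel
    have h2 : inner ℂ (v x) (v y) = ∫ t in Ioi (0 : ℝ), Complex.exp ((conj (a x) + a y) * t) := by
      rw [L2.inner_def]
      refine integral_congr_ae ?_
      filter_upwards [hc x, hc y] with t hx hy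
      rw [hx, hy, RCLike.inner_apply, ← Complex.exp_conj, ← Complex.exp_add]
      congr 1
      simp
      ring
    have h3 : (conj (a x) + a y).re < 0 := by
      have := ha x
      have := ha y
      simp only [Complex.add_re, Complex.conj_re]
      linarith
    rw [h2, integral_exp_mul_complex_Ioi h3, h1]
    have h4 : conj (a x) + a y = - (-Complex.I * ((x : ℂ) - conj (y : ℂ))) := by
      simp [a]
      ring
    rw [h4]
    simp [scalarKernel, szegoKernel, neg_div, div_neg]
  obtain ⟨u, hu, ht⟩ := RKHS.exists_total (H := Hardy) v hv
    (e := fun s : ℝ => indicatorConstLp 2 (measurableSet_Iic (a := s)) (hfin s) (1 : ℂ))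
    fun f hf => indicator_Iic_total hfin f fun s => by
      rw [← L2.inner_indicatorConstLp_one measurableSet_Iic (hfin s)]
      exact hf s
  have hval : ∀ s l, u s l = conj (∫ t in Ioc (0 : ℝ) s, Complex.exp (a l * t)) := fun s l => by
    rw [hu, ← inner_conj_symm, L2.inner_indicatorConstLp_one,
      setIntegral_congr_ae measurableSet_Iic ((hc l).mono fun t h _ => h),
      Measure.restrict_restrict measurableSet_Iic, Iic_inter_Ioi]
  refine ⟨u, fun s hs l => ?_, fun s hs => RKHS.ext fun l => ?_, ht⟩
  · have hne : a l ≠ 0 := fun h => by simpa [h] using ha l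
    have hl : (l : ℂ) ≠ 0 := UpperHalfPlane.ne_zero l
    rw [hval, ← intervalIntegral.integral_of_le hs, integral_exp_mul_complex hne]
    simp [a, ← Complex.exp_conj]
    ring_nf
  · rw [hval, Ioc_eq_empty (by linarith)]
    simp

/-! ### Monomials in `H(K_k)` -/

theorem twoNPow_pos (α : ℕ+ →₀ ℕ) : 0 < twoNPow α :=
  Finset.prod_pos fun j _ => pow_pos (mul_pos two_pos (Nat.cast_pos.mpr j.pos)) _

theorem multiPow_add (z : ℕ+ → ℂ) (α β : ℕ+ →₀ ℕ) :
    multiPow z (α + β) = multiPow z α * multiPow z β :=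
  Finsupp.prod_add_index' (fun _ => pow_zero _) fun _ _ _ => pow_add _ _ _

theorem multiPow_single (z : ℕ+ → ℂ) (j : ℕ+) : multiPow z (Finsupp.single j 1) = z j := by
  simp [multiPow]

theorem multiPow_conj (z : ℕ+ → ℂ) (α : ℕ+ →₀ ℕ) :
    multiPow (fun j => conj (z j)) α = conj (multiPow z α) := by
  simp [multiPow, Finsupp.prod]

/-- The monomials belong to `H(K_k)` and are total. -/
theorem KSpace.exists_total (k : ℕ) : ∃ m : (ℕ+ →₀ ℕ) → KSpace k,
    (∀ α z, m α z = multiPow z.1 α) ∧ ∀ f : KSpace k, (∀ α, inner ℂ (m α) f = 0) → f = 0 := by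
  let r : (ℕ+ →₀ ℕ) → ℝ := fun α => Real.sqrt (twoNPow α ^ k)
  have hr : ∀ α, r α ^ 2 = twoNPow α ^ k := fun α =>
    Real.sq_sqrt (pow_nonneg (twoNPow_pos α).le k)
  have hr0 : ∀ α, (r α : ℂ) ≠ 0 := fun α =>
    Complex.ofReal_ne_zero.mpr (Real.sqrt_pos.mpr (pow_pos (twoNPow_pos α) k)).ne'
  -- Pairing with the unit vector at `α` gives `r α * z ^ α`; dividing by `r α` below leaves the
  -- plain monomial.
  let v : kNhd k → lp (fun _ : ℕ+ →₀ ℕ => ℂ) 2 := fun z =>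
    ⟨fun α => conj (multiPow z.1 α) * r α, by
      refine memℓp_gen ?_
      have hz : Summable fun α => ‖multiPow z.1 α‖ ^ 2 * twoNPow α ^ k := z.2
      refine hz.congr fun α => ?_
      rw [norm_mul, RCLike.norm_conj, Complex.norm_real, ENNReal.toReal_ofNat, Real.rpow_ofNat,
        mul_pow, Real.norm_eq_abs, sq_abs, hr]⟩
  have hv : ∀ z w, RKHS.kernel (KSpace k) z w 1 = inner ℂ (v z) (v w) := fun z w => by
    have h1 : RKHS.kernel (KSpace k) = scalarKernel (kKernel k) := RKHS.OfKernel.kernel_ofKernel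
    rw [h1, lp.inner_eq_tsum]
    simp only [scalarKernel, Matrix.of_apply, smul_apply,
      ContinuousLinearMap.id_apply, smul_eq_mul, mul_one, kKernel]
    refine tsum_congr fun α => ?_
    rw [multiPow_conj, RCLike.inner_apply, ← Complex.ofReal_pow, ← hr]
    simp only [v, map_mul, Complex.conj_conj, Complex.conj_ofReal, Complex.ofReal_pow]
    ring
  classical
  obtain ⟨u, hu, ht⟩ := RKHS.exists_total (H := KSpace k) v hv
    (e := fun α => lp.single 2 α (1 : ℂ)) fun f hf => by
      ext α
      have := hf α
      rw [lp.inner_single_left] at this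
      simpa using this
  refine ⟨fun α => (r α : ℂ)⁻¹ • u α, fun α z => ?_, fun f hf => ht f fun α => ?_⟩
  · rw [RKHS.coe_smul, Pi.smul_apply, hu, lp.inner_single_right, RCLike.inner_apply]
    simp only [v, map_mul, Complex.conj_conj, Complex.conj_ofReal, smul_eq_mul, one_mul]
    field_simp [hr0 α]
  · have h := hf α
    rw [inner_smul_left] at h
    exact (mul_eq_zero.mp h).resolve_left (by simpa using hr0 α)

/-! ### Functionals compatible with multiplication -/

section Eval

variable {X H : Type*} [NormedAddCommGroup H] [InnerProductSpace ℂ H] [CompleteSpace H]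
  [RKHS ℂ H X ℂ]

/-- Evaluation at `x` as a bounded functional. -/
def evalCLM (x : X) : H →L[ℂ] ℂ := innerSL ℂ (RKHS.kerFun H x 1)

theorem evalCLM_apply (x : X) (f : H) : evalCLM x f = f x := RKHS.inner_kerFun_one f x

end Eval

/-- A bounded functional on the Hardy space that intertwines multiplication by `exp (i s ·)` with
multiplication by its value at `l` is a multiple of the evaluation at `l`. -/
theorem Hardy.functional_eq_smul_eval (ℓ : Hardy →L[ℂ] ℂ) (l : UpperHalfPlane)
    (h : ∀ s : ℝ, 0 ≤ s → ∀ f g : Hardy, (∀ x : UpperHalfPlane,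
      g x = Complex.exp (Complex.I * s * x) * f x) →
      ℓ g = Complex.exp (Complex.I * s * l) * ℓ f) :
    ∃ c : ℂ, ∀ f : Hardy, ℓ f = c * f l := by
  obtain ⟨u, hu, hneg, htot⟩ := Hardy.exists_total
  set χ : ℝ → ℂ := fun s => Complex.exp (Complex.I * s * l) with hχ
  have hadd : ∀ s t : ℝ, 0 ≤ s → 0 ≤ t → ℓ (u (s + t)) = ℓ (u s) + χ s * ℓ (u t) :=
    fun s t hs ht => by
      have := h s hs (u t) (u (s + t) - u s) fun x => by
        rw [RKHS.coe_sub, Pi.sub_apply, hu _ (add_nonneg hs ht), hu _ hs, hu _ ht,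
          Complex.ofReal_add, mul_add, add_mul, Complex.exp_add]
        ring
      rw [map_sub, sub_eq_iff_eq_add'] at this
      exact this
  have hl : Complex.I * (l : ℂ) ≠ 0 := mul_ne_zero Complex.I_ne_zero (UpperHalfPlane.ne_zero l)
  have h1 : χ 1 - 1 ≠ 0 := fun h0 => by
    have hn : ‖χ 1‖ < 1 := by
      rw [hχ, Complex.norm_exp, Real.exp_lt_one_iff]
      simpa using l.im_pos
    rw [sub_eq_zero.mp h0, norm_one] at hn
    exact lt_irrefl _ hn
  -- The factor is forced: it is `ℓ (u 1)` divided by `u 1 l`, which is nonzero because `‖χ 1‖ = exp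
  -- (-Im l) < 1`.
  refine ⟨ℓ (u 1) * (Complex.I * l) / (χ 1 - 1), fun f => ?_⟩
  have heq : ℓ = (ℓ (u 1) * (Complex.I * l) / (χ 1 - 1)) • evalCLM l := by
    refine clm_eq_of_total htot fun s => ?_
    rw [smul_apply, evalCLM_apply, smul_eq_mul]
    rcases lt_or_ge s 0 with hs | hs
    · simp [hneg s hs]
    -- Splitting `1 + s` in both orders gives `(χ 1 - 1) ℓ(u_s) = (χ s - 1) ℓ(u_1)`.
    · have e := (hadd 1 s zero_le_one hs).symm.trans
        ((congrArg (fun r => ℓ (u r)) (add_comm 1 s)).trans (hadd s 1 hs zero_le_one))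
      rw [hu s hs]
      change _ = _ * ((χ s - 1) / _)
      field_simp
      linear_combination e
  conv_lhs => rw [heq]
  simp only [smul_apply, evalCLM_apply, smul_eq_mul]

/-- A bounded functional on `H(K_k)` that intertwines multiplication by the coordinates with
multiplication by their values at `z` is a multiple of the evaluation at `z`. -/
theorem KSpace.functional_eq_smul_eval (k : ℕ) : ∃ g₀ : KSpace k,
    ∀ (ℓ : KSpace k →L[ℂ] ℂ) (z : kNhd k), (∀ j : ℕ+, ∀ f g : KSpace k,
      (∀ w : kNhd k, g w = w.1 j * f w) → ℓ g = z.1 j * ℓ f) →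
    ∀ f : KSpace k, ℓ f = ℓ g₀ * f z := by
  obtain ⟨m, hm, htot⟩ := KSpace.exists_total k
  -- The constant function `1`. It depends on neither `ℓ` nor `z`, so in the tensor product one
  -- vector serves for all slices.
  refine ⟨m 0, fun ℓ z h f => ?_⟩
  have hmon : ∀ α n j, ℓ (m (α + Finsupp.single j n)) = z.1 j ^ n * ℓ (m α) := fun α n j => by
    induction n with
    | zero => simp
    | succ n ih =>
      rw [h j (m (α + Finsupp.single j n)), ih, pow_succ', mul_assoc]
      intro w
      rw [hm, hm, Finsupp.single_add, ← add_assoc, multiPow_add, multiPow_single, mul_comm]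
  have hall : ∀ α, ℓ (m α) = ℓ (m 0) * multiPow z.1 α := fun α => by
    induction α using Finsupp.induction with
    | zero => simp [multiPow]
    | single_add j n α _ _ ih =>
      rw [add_comm, hmon, ih, multiPow_add]
      simp [multiPow]
      ring
  have heq : ℓ = ℓ (m 0) • evalCLM z := clm_eq_of_total htot fun α => by
    rw [smul_apply, evalCLM_apply, smul_eq_mul, hm, hall]
  conv_lhs => rw [heq]
  simp [evalCLM_apply]

/-- `(f, g) ↦ f ⊗ g` as a bounded bilinear map. -/
def pureTensorL (k : ℕ) : Hardy →L[ℂ] KSpace k →L[ℂ] HardyTensor k :=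
  (ContinuousLinearMap.compL ℂ (KSpace k) (Hardy ⊗[ℂ] KSpace k) (HardyTensor k)
    UniformSpace.Completion.toComplL) ∘L TensorProduct.mkL ℂ Hardy (KSpace k)

theorem HardyTensor.clm_ext {k : ℕ} {a b : HardyTensor k →L[ℂ] ℂ}
    (h : ∀ f g, a (pureTensor f g) = b (pureTensor f g)) : a = b := by
  refine ContinuousLinearMap.ext fun F => ?_
  induction F using UniformSpace.Completion.induction_on with
  | hp => exact isClosed_eq a.continuous b.continuous
  | ih x =>
    induction x with
    | zero => rw [UniformSpace.Completion.coe_zero, map_zero, map_zero]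
    | tmul f g => exact h f g
    | add x y hx hy => rw [UniformSpace.Completion.coe_add, map_add, map_add, hx, hy]

/-- Separation of variables: the coordinates give `L(f ⊗ g) = L(f ⊗ 1) g(z)`, and the exponentials
then give `L(f ⊗ 1) = c f(λ)`. -/
theorem HardyTensor.functional_eq_smul_eval {k : ℕ} (L : HardyTensor k →L[ℂ] ℂ)
    (p : UpperHalfPlane × kNhd k)
    (hχ : ∀ s : ℝ, 0 ≤ s → ∀ F G : HardyTensor k,
      (∀ q, G q = Complex.exp (Complex.I * (s : ℂ) * (q.1 : ℂ)) * F q) →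
      L G = Complex.exp (Complex.I * (s : ℂ) * (p.1 : ℂ)) * L F)
    (hz : ∀ j : ℕ+, ∀ F G : HardyTensor k, (∀ q, G q = q.2.1 j * F q) → L G = p.2.1 j * L F) :
    ∃ c : ℂ, ∀ F, L F = c * F p := by
  obtain ⟨g₀, hg⟩ := KSpace.functional_eq_smul_eval k
  obtain ⟨c, hc⟩ := Hardy.functional_eq_smul_eval (L ∘L (pureTensorL k).flip g₀) p.1
    fun s hs f g hfg => hχ s hs (pureTensor f g₀) (pureTensor g g₀) fun q => by
      rw [pureTensor_apply, pureTensor_apply, hfg, mul_assoc]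
  refine ⟨c, fun F => ?_⟩
  have heq : L = c • evalCLM p := HardyTensor.clm_ext fun f g => by
    have h1 := hg (L ∘L pureTensorL k f) p.2 (fun j g g' hgg =>
      hz j (pureTensor f g) (pureTensor f g') fun q => by
        rw [pureTensor_apply, pureTensor_apply, hgg]
        ring) g
    have h2 : L (pureTensor f g₀) = c * f p.1 := hc f
    change L (pureTensor f g) = L (pureTensor f g₀) * g p.2 at h1
    rw [h1, h2, smul_apply, evalCLM_apply, pureTensor_apply, smul_eq_mul, mul_assoc]
  rw [heq]
  simp [evalCLM_apply]

/-! ### Contractive multipliers -/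

/-- If multiplication by `S` is a contraction of `H`, then the kernel `(1 - S S*) K` is positive. -/
theorem RKHS.posSemidef_of_contractive_multiplier {X H : Type*} [NormedAddCommGroup H]
    [InnerProductSpace ℂ H] [CompleteSpace H] [RKHS ℂ H X ℂ] (T : H →L[ℂ] H)
    (hT : ∀ F, ‖T F‖ ≤ ‖F‖) (S : X → ℂ) (hS : ∀ F p, T F p = S p * F p) :
    (Matrix.of fun p q : X => (1 - S p * conj (S q)) * RKHS.kernel H p q 1).PosSemidef := by
  have hadj : ∀ p, T.adjoint (RKHS.kerFun H p 1) = conj (S p) • RKHS.kerFun H p 1 := fun p => by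
    refine ext_inner_right ℂ fun F => ?_
    rw [ContinuousLinearMap.adjoint_inner_left, RKHS.inner_kerFun_one, inner_smul_left,
      RKHS.inner_kerFun_one, hS, Complex.conj_conj]
  have hn : ‖T.adjoint‖ ≤ 1 := by
    rw [LinearIsometryEquiv.norm_map]
    exact T.opNorm_le_bound zero_le_one fun F => by simpa using hT F
  refine ⟨?_, fun x => ?_⟩
  · ext p q
    rw [Matrix.conjTranspose_apply, Matrix.of_apply, Matrix.of_apply,
      ← RKHS.inner_kerFun_kerFun_one, ← RKHS.inner_kerFun_kerFun_one, RCLike.star_def, map_mul,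
      inner_conj_symm]
    simp [mul_comm]
  · let F : H := x.sum fun p c => c • RKHS.kerFun H p 1
    have hF : T.adjoint F = x.sum fun p c => (c * conj (S p)) • RKHS.kerFun H p 1 := by
      simp only [F, map_finsuppSum, map_smul, hadj, smul_smul]
    -- The quadratic form of the kernel is `‖F‖² - ‖T* F‖²`.
    have hsum : (x.sum fun p c => x.sum fun q d => star c *
        (Matrix.of fun p q : X => (1 - S p * conj (S q)) * RKHS.kernel H p q 1) p q * d) =
        inner ℂ F F - inner ℂ (T.adjoint F) (T.adjoint F) := by
      rw [hF]
      simp only [F, Finsupp.sum_inner, Finsupp.inner_sum, inner_smul_left, inner_smul_right,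
        RKHS.inner_kerFun_kerFun_one]
      rw [Finsupp.sum_comm, ← Finsupp.sum_sub]
      refine Finsupp.sum_congr fun p _ => ?_
      rw [Finsupp.mul_sum, Finsupp.mul_sum, ← Finsupp.sum_sub]
      refine Finsupp.sum_congr fun q _ => ?_
      simp only [Matrix.of_apply, RCLike.star_def, map_mul, Complex.conj_conj]
      ring
    rw [hsum, inner_self_eq_norm_sq_to_K, inner_self_eq_norm_sq_to_K, sub_nonneg]
    have hle : ‖T.adjoint F‖ ≤ ‖F‖ := by
      simpa using T.adjoint.le_of_opNorm_le hn F
    exact_mod_cast pow_le_pow_left₀ (norm_nonneg _) hle 2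

end

theorem mainTheorem6 (k : ℕ) (hk : 1 ≤ k)
    (T : HardyTensor k →ₗ[ℂ] HardyTensor k) (hT : ∀ F, ‖T F‖ ≤ ‖F‖)
    (hχ : ∀ t : ℝ, 0 ≤ t →
      CommutesWithMul T fun p => Complex.exp (Complex.I * (t : ℂ) * (p.1 : ℂ)))
    (hz : ∀ j : ℕ+, CommutesWithMul T fun p => p.2.1 j) :
    ∃ S : UpperHalfPlane × kNhd k → ℂ,
      (∀ (F : HardyTensor k) (p : UpperHalfPlane × kNhd k), (T F) p = S p * F p) ∧
      (Matrix.of fun p q : UpperHalfPlane × kNhd k =>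
        (1 - S p * conj (S q)) * kKernel k p.2 q.2 /
          (-Complex.I * ((p.1 : ℂ) - conj (q.1 : ℂ)))).PosSemidef := by
  let T' : HardyTensor k →L[ℂ] HardyTensor k := T.mkContinuous 1 fun F => by simpa using hT F
  have hp : ∀ p, ∃ c : ℂ, ∀ F, T F p = c * F p := fun p => by
    obtain ⟨c, hc⟩ := HardyTensor.functional_eq_smul_eval (evalCLM p ∘L T') p
      (fun s hs F G hFG => by
        change evalCLM p (T G) = _ * evalCLM p (T F)
        rw [evalCLM_apply, evalCLM_apply]
        exact hχ s hs F G hFG p)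
      (fun j F G hFG => by
        change evalCLM p (T G) = _ * evalCLM p (T F)
        rw [evalCLM_apply, evalCLM_apply]
        exact hz j F G hFG p)
    exact ⟨c, fun F => (evalCLM_apply p (T F)).symm.trans (hc F)⟩
  choose S hS using hp
  refine ⟨S, fun F p => hS p F, ?_⟩
  have h := RKHS.posSemidef_of_contractive_multiplier T' hT S fun F p => hS p F
  simpa only [kernel_hardyTensor, ← mul_div_assoc] using h
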